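/- Let $k$ be a field and let $\mathcal{L}$ be a finite distributive lattice. Call $x\in\mathcal{L}$ join-irreducible if $x=y\vee z$ implies $x=y$ or $x=z$ (so the least element is join-irreducible), and let $J(\mathcal{L})$ be the set of join-irreducible elements. Let $I(\mathcal{L})\subset k[x_\beta : \beta\in\mathcal{L}]$ be the ideal generated by the diamond relations $x_\beta x_\gamma-x_{\beta\vee\gamma}x_{\beta\wedge\gamma}$, for $\beta,\gamma\in\mathcal{L}$ non-comparable, and let $V(I(\mathcal{L}))=\operatorname{Spec} k[x_\beta : \beta\in\mathcal{L}]/I(\mathcal{L})\subset\mathbb{A}^{|\mathcal{L}|}$. A diamond is a set $\{x,y,x\vee y,x\wedge y\}$ with $x,y\in\mathcal{L}$ non-comparable; its two pairs of opposite corners are $\{x,y\}$ and $\{x\vee y,x\wedge y\}$. For $\alpha\in\mathcal{L}$ let $E_\alpha$ be the set of pairs $(\alpha,\gamma)$ such that $\alpha$ and $\gamma$ are opposite corners of some diamond. Let $c\in k$, $c\neq 0$, and let $p_\alpha$ be the point of $\mathbb{A}^{|\mathcal{L}|}$ whose $\alpha$-th coordinate is $c$ and whose other coordinates are $0$. Then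 $p_\alpha\in V(I(\mathcal{L}))$, and the Jacobian matrix of the diamond relations at $p_\alpha$ has rank at least $|E_\alpha|$. Moreover, if $|E_\alpha|\ge|\mathcal{L}|-|J(\mathcal{L})|$, then $p_\alpha$ is a smooth point of $V(I(\mathcal{L}))$, i.e. the local ring of $V(I(\mathcal{L}))$ at $p_\alpha$ is a regular local ring. -/

import Mathlib

/-! ### Affine schemes `V(I) ⊆ 𝔸^σ` at a rational point -/

/-- Evaluation at a rational point `p` of `V(I)`, on the coordinate ring `k[x_σ] / I`. -/
noncomputable def evalAt {k σ : Type*} [Field k] (I : Ideal (MvPolynomial σ k)) (p : σ → k)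
    (hp : p ∈ MvPolynomial.zeroLocus k I) : (MvPolynomial σ k ⧸ I) →ₐ[k] k :=
  Ideal.Quotient.liftₐ I (MvPolynomial.aeval p) hp

/-- The maximal ideal of the coordinate ring `k[x_σ] / I` of functions vanishing at `p`. -/
noncomputable def pointIdeal {k σ : Type*} [Field k] (I : Ideal (MvPolynomial σ k)) (p : σ → k)
    (hp : p ∈ MvPolynomial.zeroLocus k I) : Ideal (MvPolynomial σ k ⧸ I) :=
  RingHom.ker (evalAt I p hp)

instance pointIdeal_isPrime {k σ : Type*} [Field k] (I : Ideal (MvPolynomial σ k)) (p : σ → k)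
    (hp : p ∈ MvPolynomial.zeroLocus k I) : (pointIdeal I p hp).IsPrime :=
  RingHom.ker_isPrime (evalAt I p hp)

/-- `p` lies on `V(I)` and is a smooth (nonsingular) point of it: the local ring of
`V(I) = Spec (k[x_σ] / I)` at `p` is a regular local ring. -/
def IsSmoothPoint {k σ : Type*} [Field k] (I : Ideal (MvPolynomial σ k)) (p : σ → k) : Prop :=
  ∃ hp : p ∈ MvPolynomial.zeroLocus k I,
    IsRegularLocalRing (Localization.AtPrime (pointIdeal I p hp))

/-- The Jacobian matrix `(∂f/∂x_i (p))` of a set `S` of polynomials at `p`; the rows are indexed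
by `f ∈ S`, the columns by the variables. -/
noncomputable def jacobianAt {k σ : Type*} [Field k] (S : Set (MvPolynomial σ k)) (p : σ → k) :
    Matrix S σ k :=
  Matrix.of fun f i => MvPolynomial.eval p (MvPolynomial.pderiv i (f : MvPolynomial σ k))

/-- The point of affine space whose `a`-th coordinate is `c` and whose other coordinates are `0`. -/
noncomputable def axisPoint {k σ : Type*} [Field k] (a : σ) (c : k) : σ → k :=
  open Classical in fun b => if b = a then c else 0

/-! ### The lattice side -/

/-- The set `J(L)` of join-irreducible elements: `x = y ⊔ z` forces `x = y` or `x = z`.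
The least element counts as join-irreducible. -/
def joinIrreducibles (L : Type*) [DistribLattice L] : Set L :=
  {x | ∀ y z : L, x = y ⊔ z → x = y ∨ x = z}

/-- `x` and `y` are non-comparable; then `{x, y, x ⊔ y, x ⊓ y}` is a diamond. -/
def NonComparable {L : Type*} [DistribLattice L] (x y : L) : Prop := ¬ x ≤ y ∧ ¬ y ≤ x

/-- The diamond relations `x_a x_b - x_{a ⊔ b} x_{a ⊓ b}`, for `a`, `b` non-comparable. -/
noncomputable def diamondRelations (k L : Type*) [Field k] [DistribLattice L] : Set (MvPolynomial L k) :=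
  {f | ∃ a b : L, NonComparable a b ∧
    f = MvPolynomial.X a * MvPolynomial.X b - MvPolynomial.X (a ⊔ b) * MvPolynomial.X (a ⊓ b)}

/-- The ideal `I(L)` generated by the diamond relations. -/
noncomputable def latticeIdeal (k L : Type*) [Field k] [DistribLattice L] : Ideal (MvPolynomial L k) :=
  Ideal.span (diamondRelations k L)

/-- `a` and `g` are opposite corners of some diamond `{x, y, x ⊔ y, x ⊓ y}`: either they are its
two non-comparable elements, or they are its top and its bottom, in one of the two orders. -/
def OppositeInDiamond {L : Type*} [DistribLattice L] (a g : L) : Prop :=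
  ∃ x y : L, NonComparable x y ∧
    ((a = x ∧ g = y) ∨ (a = x ⊔ y ∧ g = x ⊓ y) ∨ (a = x ⊓ y ∧ g = x ⊔ y))

/-- The set `E_a` of pairs `(a, g)` with `a` and `g` opposite corners of some diamond. Each pair
is counted once, however many diamonds have it as a diagonal. -/
def diamondPairs {L : Type*} [DistribLattice L] (a : L) : Set (L × L) :=
  {q | q.1 = a ∧ OppositeInDiamond a q.2}

/-! ### Diamonds through a fixed element -/

section Diamonds

variable {L : Type*} [DistribLattice L]

/-! If `{a, g}` and `{u, v}` are the diagonals of a diamond, then `x_a x_g = x_u x_v` up to sign of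
the relation. Its differential at the point is `±c dx_g`, since `u` and `v` differ from `a`; one
such row for each opposite `g` gives the rank bound.

For smoothness, `x_g = x_u x_v / x_a` where `x_a` is invertible, so the variables not opposite to
`a` generate the coordinate ring there (`diamond_induction`, `exists_pow_mul_eq_chartMap`). They are
also algebraically independent: `toricMap` sends them to monomials whose exponents span `ℚ^J`, and
by hypothesis there are at most `|J|` of them (`linearIndependent_weight`). The local ring is
therefore a localization of a polynomial ring at a prime, hence regular. -/

/-- `{a, g}` and `{u, v}` are the two diagonals of a diamond. -/
def DiamondDiagonals (a g u v : L) : Prop :=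
  (NonComparable a g ∧ u = a ⊔ g ∧ v = a ⊓ g) ∨
    (NonComparable u v ∧ ((a = u ⊔ v ∧ g = u ⊓ v) ∨ (a = u ⊓ v ∧ g = u ⊔ v)))

theorem oppositeInDiamond_iff {a g : L} :
    OppositeInDiamond a g ↔ ∃ u v, DiamondDiagonals a g u v := by
  constructor
  · rintro ⟨x, y, h, ⟨rfl, rfl⟩ | h' | h'⟩
    · exact ⟨_, _, .inl ⟨h, rfl, rfl⟩⟩
    · exact ⟨x, y, .inr ⟨h, .inl h'⟩⟩
    · exact ⟨x, y, .inr ⟨h, .inr h'⟩⟩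
  · rintro ⟨u, v, ⟨h, -, -⟩ | ⟨h, h' | h'⟩⟩
    · exact ⟨a, g, h, .inl ⟨rfl, rfl⟩⟩
    · exact ⟨u, v, h, .inr (.inl h')⟩
    · exact ⟨u, v, h, .inr (.inr h')⟩

namespace NonComparable

variable {x y : L}

theorem ne (h : NonComparable x y) : x ≠ y := fun e => h.1 e.le

theorem left_ne_sup (h : NonComparable x y) : x ≠ x ⊔ y := fun e => h.2 (left_eq_sup.1 e)

theorem right_ne_sup (h : NonComparable x y) : y ≠ x ⊔ y := fun e => h.1 (right_eq_sup.1 e)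

theorem left_ne_inf (h : NonComparable x y) : x ≠ x ⊓ y := fun e => h.1 (left_eq_inf.1 e)

theorem right_ne_inf (h : NonComparable x y) : y ≠ x ⊓ y := fun e => h.2 (right_eq_inf.1 e)

theorem sup_ne_inf (h : NonComparable x y) : x ⊔ y ≠ x ⊓ y := fun e =>
  h.1 (le_sup_left.trans (e.le.trans inf_le_right))

end NonComparable

namespace DiamondDiagonals

variable {a g u v : L}

theorem ne (h : DiamondDiagonals a g u v) : a ≠ g := by
  rcases h with ⟨h, -, -⟩ | ⟨h, ⟨rfl, rfl⟩ | ⟨rfl, rfl⟩⟩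
  exacts [h.ne, h.sup_ne_inf, h.sup_ne_inf.symm]

theorem ne_left (h : DiamondDiagonals a g u v) : a ≠ u := by
  rcases h with ⟨h, rfl, rfl⟩ | ⟨h, ⟨rfl, rfl⟩ | ⟨rfl, rfl⟩⟩
  exacts [h.left_ne_sup, h.left_ne_sup.symm, h.left_ne_inf.symm]

theorem ne_right (h : DiamondDiagonals a g u v) : a ≠ v := by
  rcases h with ⟨h, rfl, rfl⟩ | ⟨h, ⟨rfl, rfl⟩ | ⟨rfl, rfl⟩⟩
  exacts [h.left_ne_inf, h.right_ne_sup.symm, h.right_ne_inf.symm]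

theorem sup_eq_sup (h : DiamondDiagonals a g u v) : a ⊔ g = u ⊔ v := by
  rcases h with ⟨h, rfl, rfl⟩ | ⟨h, ⟨rfl, rfl⟩ | ⟨rfl, rfl⟩⟩
  · exact (sup_eq_left.2 inf_le_sup).symm
  · exact sup_eq_left.2 inf_le_sup
  · exact sup_eq_right.2 inf_le_sup

theorem inf_eq_inf (h : DiamondDiagonals a g u v) : a ⊓ g = u ⊓ v := by
  rcases h with ⟨h, rfl, rfl⟩ | ⟨h, ⟨rfl, rfl⟩ | ⟨rfl, rfl⟩⟩
  · exact (inf_eq_right.2 inf_le_sup).symm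
  · exact inf_eq_right.2 inf_le_sup
  · exact inf_eq_left.2 inf_le_sup

end DiamondDiagonals

theorem not_oppositeInDiamond_self (a : L) : ¬ OppositeInDiamond a a := fun h => by
  obtain ⟨u, v, h⟩ := oppositeInDiamond_iff.1 h
  exact h.ne rfl

/-- A property that holds for the elements that are not opposite to `a`, and for `g` as soon as it
holds for the other diagonal of a diamond with diagonal `{a, g}`, holds everywhere. -/
theorem diamond_induction [Finite L] (a : L) {P : L → Prop}
    (base : ∀ g, ¬ OppositeInDiamond a g → P g)
    (step : ∀ g u v, DiamondDiagonals a g u v → P u → P v → P g) (g : L) : P g := by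
  -- The measure is the size of the interval spanned by `a` and `g`; passing from `g` to `u` or `v`
  -- shrinks it strictly.
  induction hn : (Set.Icc (a ⊓ g) (a ⊔ g)).ncard using Nat.strong_induction_on generalizing g with
  | _ n ih =>
  subst hn
  by_cases hg : OppositeInDiamond a g
  · obtain ⟨u, v, h⟩ := oppositeInDiamond_iff.1 hg
    suffices key : Set.Icc (a ⊓ u) (a ⊔ u) ⊂ Set.Icc (a ⊓ g) (a ⊔ g) ∧
        Set.Icc (a ⊓ v) (a ⊔ v) ⊂ Set.Icc (a ⊓ g) (a ⊔ g) from
      step g u v h (ih _ (Set.ncard_lt_ncard key.1) u rfl) (ih _ (Set.ncard_lt_ncard key.2) v rfl)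
    rcases h with ⟨h, rfl, rfl⟩ | ⟨h, ⟨rfl, rfl⟩ | ⟨rfl, rfl⟩⟩
    · have h1 : a ⊓ (a ⊔ g) = a := inf_sup_self
      have h2 : a ⊔ (a ⊔ g) = a ⊔ g := sup_left_idem a g
      have h3 : a ⊓ (a ⊓ g) = a ⊓ g := inf_left_idem a g
      have h4 : a ⊔ (a ⊓ g) = a := sup_inf_self
      rw [h1, h2, h3, h4]
      exact ⟨Set.Icc_ssubset_Icc_left inf_le_sup (inf_le_left.lt_of_ne h.left_ne_inf.symm) le_rfl,
        Set.Icc_ssubset_Icc_right inf_le_sup le_rfl (le_sup_left.lt_of_ne h.left_ne_sup)⟩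
    · have h1 : (u ⊔ v) ⊓ (u ⊓ v) = u ⊓ v := inf_eq_right.2 inf_le_sup
      have h2 : (u ⊔ v) ⊔ (u ⊓ v) = u ⊔ v := sup_eq_left.2 inf_le_sup
      have h3 : (u ⊔ v) ⊓ u = u := inf_eq_right.2 le_sup_left
      have h4 : (u ⊔ v) ⊔ u = u ⊔ v := sup_eq_left.2 le_sup_left
      have h5 : (u ⊔ v) ⊓ v = v := inf_eq_right.2 le_sup_right
      have h6 : (u ⊔ v) ⊔ v = u ⊔ v := sup_eq_left.2 le_sup_right
      rw [h1, h2, h3, h4, h5, h6]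
      exact ⟨Set.Icc_ssubset_Icc_left inf_le_sup (inf_le_left.lt_of_ne h.left_ne_inf.symm) le_rfl,
        Set.Icc_ssubset_Icc_left inf_le_sup (inf_le_right.lt_of_ne h.right_ne_inf.symm) le_rfl⟩
    · have h1 : (u ⊓ v) ⊓ (u ⊔ v) = u ⊓ v := inf_eq_left.2 inf_le_sup
      have h2 : (u ⊓ v) ⊔ (u ⊔ v) = u ⊔ v := sup_eq_right.2 inf_le_sup
      have h3 : (u ⊓ v) ⊓ u = u ⊓ v := inf_eq_left.2 inf_le_left
      have h4 : (u ⊓ v) ⊔ u = u := sup_eq_right.2 inf_le_left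
      have h5 : (u ⊓ v) ⊓ v = u ⊓ v := inf_eq_left.2 inf_le_right
      have h6 : (u ⊓ v) ⊔ v = v := sup_eq_right.2 inf_le_right
      rw [h1, h2, h3, h4, h5, h6]
      exact ⟨Set.Icc_ssubset_Icc_right inf_le_sup le_rfl (le_sup_left.lt_of_ne h.left_ne_sup),
        Set.Icc_ssubset_Icc_right inf_le_sup le_rfl (le_sup_right.lt_of_ne h.right_ne_sup)⟩
  · exact base g hg

end Diamonds

/-! ### Weights of the elements by join-irreducibles below them -/

section Weights

variable {L : Type*} [DistribLattice L]

/-- By distributivity `p = (p ⊓ b) ⊔ (p ⊓ c)`, so irreducible elements are prime. -/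
theorem le_sup_iff_of_mem_joinIrreducibles {p : L} (hp : p ∈ joinIrreducibles L) {b c : L} :
    p ≤ b ⊔ c ↔ p ≤ b ∨ p ≤ c := by
  refine ⟨fun h => ?_, fun h => h.elim le_sup_of_le_left le_sup_of_le_right⟩
  have := hp (p ⊓ b) (p ⊓ c) (by rw [← inf_sup_left, inf_eq_left.2 h])
  simpa only [left_eq_inf] using this

variable [Finite L]

open Classical in
/-- The indicator of the join-irreducible elements below `b`, as an exponent vector. -/
noncomputable def weight (b : L) : joinIrreducibles L →₀ ℕ :=
  Finsupp.equivFunOnFinite.symm fun p => if (p : L) ≤ b then 1 else 0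

open Classical in
theorem weight_apply (b : L) (p : joinIrreducibles L) :
    weight b p = if (p : L) ≤ b then 1 else 0 := rfl

theorem weight_add_weight (b c : L) : weight b + weight c = weight (b ⊔ c) + weight (b ⊓ c) := by
  ext p
  have h := le_sup_iff_of_mem_joinIrreducibles p.2 (b := b) (c := c)
  simp only [Finsupp.add_apply, weight_apply, le_inf_iff]
  by_cases h1 : (p : L) ≤ b <;> by_cases h2 : (p : L) ≤ c <;> simp [h, h1, h2]

theorem DiamondDiagonals.weight_add_weight {a g u v : L} (h : DiamondDiagonals a g u v) :
    weight a + weight g = weight u + weight v := by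
  rw [_root_.weight_add_weight, _root_.weight_add_weight u, h.sup_eq_sup, h.inf_eq_inf]

/-- The weight of `b` as a rational vector. -/
noncomputable def ratWeight (b : L) : joinIrreducibles L → ℚ := fun p => weight b p

/-- The weights of the join-irreducibles are unitriangular: that of `p` is the sum of the basis
vectors at all `q ≤ p`. -/
theorem span_range_ratWeight : Submodule.span ℚ (Set.range (ratWeight (L := L))) = ⊤ := by
  classical
  have := Fintype.ofFinite (joinIrreducibles L)
  suffices h : ∀ p : joinIrreducibles L,
      Pi.single p (1 : ℚ) ∈ Submodule.span ℚ (Set.range (ratWeight (L := L))) by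
    rw [eq_top_iff, ← (Pi.basisFun ℚ (joinIrreducibles L)).span_eq, Submodule.span_le]
    rintro _ ⟨p, rfl⟩
    simpa using h p
  intro p
  induction p using WellFoundedLT.induction with
  | _ p ih =>
  have key : Pi.single p (1 : ℚ) = ratWeight (p : L) -
      ∑ q ∈ Finset.univ.filter (fun q => q < p), Pi.single q (1 : ℚ) := by
    ext r
    simp only [Pi.sub_apply, Finset.sum_apply, Pi.single_apply, Finset.sum_ite_eq, ratWeight,
      weight_apply, Finset.mem_filter, Finset.mem_univ, true_and, Subtype.coe_le_coe]
    rcases eq_or_ne r p with rfl | hr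
    · simp
    · simp [hr, le_iff_lt_or_eq]
  rw [key]
  refine Submodule.sub_mem _ (Submodule.subset_span ⟨_, rfl⟩) (Submodule.sum_mem _ fun q hq => ?_)
  exact ih q (Finset.mem_filter.1 hq).2

/-- The diamond relation makes the weight of `g` equal to that of `u` plus `v` minus `a`, so
opposite elements are redundant. -/
theorem span_range_ratWeight_not_oppositeInDiamond (a : L) :
    Submodule.span ℚ (Set.range fun b : {b : L // ¬ OppositeInDiamond a b} => ratWeight (b : L)) =
      ⊤ := by
  rw [eq_top_iff, ← span_range_ratWeight, Submodule.span_le]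
  rintro _ ⟨g, rfl⟩
  induction g using diamond_induction a with
  | base g hg => exact Submodule.subset_span ⟨⟨g, hg⟩, rfl⟩
  | step g u v h hu hv =>
    have ha := Submodule.subset_span (R := ℚ) (Set.mem_range_self
      (f := fun b : {b : L // ¬ OppositeInDiamond a b} => ratWeight (b : L))
      ⟨a, not_oppositeInDiamond_self a⟩)
    have key : ratWeight g = ratWeight u + ratWeight v - ratWeight a := by
      ext p
      have := congrArg (fun f => ((f p : ℕ) : ℚ)) h.weight_add_weight
      simp only [Finsupp.add_apply, Nat.cast_add] at this
      simp only [ratWeight, Pi.add_apply, Pi.sub_apply]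
      linarith
    rw [key]
    exact Submodule.sub_mem _ (Submodule.add_mem _ hu hv) ha

theorem linearIndependent_weight (a : L)
    (h : Nat.card {b : L // ¬ OppositeInDiamond a b} ≤ Nat.card (joinIrreducibles L)) :
    LinearIndependent ℕ fun b : {b : L // ¬ OppositeInDiamond a b} => weight (b : L) := by
  classical
  have := Fintype.ofFinite (joinIrreducibles L)
  have := Fintype.ofFinite {b : L // ¬ OppositeInDiamond a b}
  have hQ : LinearIndependent ℚ
      fun b : {b : L // ¬ OppositeInDiamond a b} => ratWeight (b : L) :=
    linearIndependent_of_top_le_span_of_card_le_finrank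
      (span_range_ratWeight_not_oppositeInDiamond a).ge (by
        rwa [Module.finrank_fintype_fun_eq_card, ← Nat.card_eq_fintype_card,
          ← Nat.card_eq_fintype_card])
  have hN := hQ.restrict_scalars (R := ℕ) (by
    intro m n hmn
    simpa using hmn)
  let f : (joinIrreducibles L →₀ ℕ) →ₗ[ℕ] (joinIrreducibles L → ℚ) :=
    { toFun := fun m p => m p
      map_add' := fun m n => by ext; simp
      map_smul' := fun m n => by ext; simp }
  exact LinearIndependent.of_comp f hN

end Weights

/-! ### Algebraic independence of monomials -/

namespace MvPolynomial

/-- Independent exponents send distinct monomials to distinct monomials, so every coefficient of `F`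
can be read off its image. -/
theorem aeval_monomial_injective {k σ τ : Type*} [CommRing k] {v : σ → τ →₀ ℕ}
    (hv : LinearIndependent ℕ v) :
    Function.Injective (aeval (R := k) fun b => monomial (v b) (1 : k)) := by
  classical
  have key (m : σ →₀ ℕ) (F : MvPolynomial σ k) :
      coeff (Finsupp.linearCombination ℕ v m) (aeval (R := k) (fun b => monomial (v b) (1 : k)) F) =
        coeff m F := by
    induction F using MvPolynomial.induction_on' with
    | monomial n c =>
      have : aeval (R := k) (fun b => monomial (v b) (1 : k)) (monomial n c) =
          monomial (Finsupp.linearCombination ℕ v n) c := by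
        rw [aeval_monomial, algebraMap_eq, Finsupp.linearCombination_apply]
        simp only [monomial_pow, one_pow, Finsupp.prod, Finsupp.sum]
        rw [← monomial_sum_one, C_mul_monomial, mul_one]
      simp only [this, coeff_monomial, Function.Injective.eq_iff hv]
    | add p q hp hq => rw [map_add, coeff_add, coeff_add, hp, hq]
  refine (injective_iff_map_eq_zero _).2 fun F hF => ?_
  ext m
  rw [← key, hF, coeff_zero, coeff_zero]

end MvPolynomial

open MvPolynomial

/-! ### The axis point and the Jacobian at it -/

section AxisPoint

variable {k σ : Type*} [Field k]

theorem axisPoint_self (a : σ) (c : k) : axisPoint a c a = c := by simp [axisPoint]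

theorem axisPoint_of_ne {a b : σ} (c : k) (h : b ≠ a) : axisPoint a c b = 0 := by
  simp [axisPoint, h]

theorem axisPoint_mul_axisPoint (a : σ) (c : k) {u v : σ} (h : u ≠ v) :
    axisPoint a c u * axisPoint a c v = 0 := by
  rcases eq_or_ne u a with rfl | hu
  · rw [axisPoint_of_ne c h.symm, mul_zero]
  · rw [axisPoint_of_ne c hu, zero_mul]

end AxisPoint

section Relations

variable {k L : Type*} [Field k] [DistribLattice L]

theorem axisPoint_mem_zeroLocus (a : L) (c : k) :
    axisPoint a c ∈ zeroLocus k (latticeIdeal k L) := by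
  intro F hF
  suffices h : latticeIdeal k L ≤ RingHom.ker (aeval (R := k) (axisPoint a c)) from h hF
  rw [latticeIdeal, Ideal.span_le]
  rintro _ ⟨u, v, h, rfl⟩
  simp [axisPoint_mul_axisPoint a c h.ne, axisPoint_mul_axisPoint a c h.sup_ne_inf]

theorem DiamondDiagonals.exists_mem_diamondRelations {a g u v : L}
    (h : DiamondDiagonals a g u v) :
    ∃ ε : k, ε ≠ 0 ∧ C ε * (X a * X g - X u * X v) ∈ diamondRelations k L := by
  rcases h with ⟨h, rfl, rfl⟩ | ⟨h, ⟨rfl, rfl⟩ | ⟨rfl, rfl⟩⟩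
  · exact ⟨1, one_ne_zero, a, g, h, by simp⟩
  · exact ⟨-1, neg_ne_zero.2 one_ne_zero, u, v, h, by simp⟩
  · exact ⟨-1, neg_ne_zero.2 one_ne_zero, u, v, h, by simp; ring⟩

theorem DiamondDiagonals.sub_mem_latticeIdeal {a g u v : L} (h : DiamondDiagonals a g u v) :
    (X a * X g - X u * X v : MvPolynomial L k) ∈ latticeIdeal k L := by
  obtain ⟨ε, hε, hmem⟩ := h.exists_mem_diamondRelations (k := k)
  have := Ideal.mul_mem_left (latticeIdeal k L) (C ε⁻¹) (Ideal.subset_span hmem)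
  rwa [← mul_assoc, ← C_mul, inv_mul_cancel₀ hε, C_1, one_mul] at this

theorem DiamondDiagonals.eval_pderiv {a g u v : L} (h : DiamondDiagonals a g u v) (ε c : k)
    (i : L) :
    eval (axisPoint a c) (pderiv i (C ε * (X a * X g - X u * X v))) =
      open Classical in if g = i then ε * c else 0 := by
  classical
  rw [Derivation.leibniz]
  simp only [pderiv_C, map_sub, Derivation.leibniz, pderiv_X, smul_eq_mul,
    map_mul, map_add, eval_C, eval_X, axisPoint_self, axisPoint_of_ne c h.ne.symm,
    axisPoint_of_ne c h.ne_left.symm, axisPoint_of_ne c h.ne_right.symm, Pi.single_apply]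
  by_cases hi : g = i <;> simp [hi]

theorem ncard_diamondPairs (a : L) :
    (diamondPairs a).ncard = Nat.card {g : L // OppositeInDiamond a g} := by
  have : diamondPairs a = Prod.mk a '' {g | OppositeInDiamond a g} := by
    ext ⟨x, y⟩
    simp only [diamondPairs, Set.mem_ofPred_eq, Set.mem_image, Prod.mk.injEq]
    constructor
    · rintro ⟨rfl, h⟩
      exact ⟨y, h, rfl, rfl⟩
    · rintro ⟨y, h, rfl, rfl⟩
      exact ⟨rfl, h⟩
  rw [this, Set.ncard_image_of_injective _ (Prod.mk_right_injective a)]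
  exact (Nat.card_coe_set_eq _).symm

theorem ncard_diamondPairs_le_rank_jacobianAt [Fintype L] (a : L) {c : k} (hc : c ≠ 0) :
    (diamondPairs a).ncard ≤ (jacobianAt (diamondRelations k L) (axisPoint a c)).rank := by
  classical
  have hrow (g : {g : L // OppositeInDiamond a g}) : ∃ f : diamondRelations k L, ∃ d : k, d ≠ 0 ∧
      ∀ i, jacobianAt (diamondRelations k L) (axisPoint a c) f i =
        if (g : L) = i then d else 0 := by
    obtain ⟨u, v, h⟩ := oppositeInDiamond_iff.1 g.2
    obtain ⟨ε, hε, hmem⟩ := h.exists_mem_diamondRelations (k := k)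
    exact ⟨⟨_, hmem⟩, ε * c, mul_ne_zero hε hc, fun i => by
      rw [jacobianAt, Matrix.of_apply, h.eval_pderiv]⟩
  choose f d hd hf using hrow
  -- The chosen rows, cut to the columns opposite to `a`, form an invertible diagonal matrix.
  have hsub : (jacobianAt (diamondRelations k L) (axisPoint a c)).submatrix f
      (Subtype.val : {g : L // OppositeInDiamond a g} → L) = Matrix.diagonal d := by
    ext g i
    rw [Matrix.submatrix_apply, hf, Matrix.diagonal_apply]
    simp only [Subtype.coe_inj]
  have hrank : (Matrix.diagonal d).rank = Nat.card {g : L // OppositeInDiamond a g} := by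
    rw [Nat.card_eq_fintype_card]
    refine Matrix.rank_of_isUnit _ ((Matrix.isUnit_iff_isUnit_det _).2 ?_)
    rw [Matrix.det_diagonal]
    exact (Finset.prod_ne_zero_iff.2 fun g _ => hd g).isUnit
  rw [ncard_diamondPairs, ← hrank, ← hsub]
  exact Matrix.rank_submatrix_le _ _ _

end Relations

/-! ### The local ring at the axis point -/

section LocalRing

variable {k L : Type*} [Field k] [DistribLattice L]

/-- The map from the polynomial ring in the variables that are not opposite to `a` to the
coordinate ring of the variety of the lattice. -/
noncomputable def chartMap (k : Type*) [Field k] (a : L) :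
    MvPolynomial {b : L // ¬ OppositeInDiamond a b} k →ₐ[k] MvPolynomial L k ⧸ latticeIdeal k L :=
  (Ideal.Quotient.mkₐ k (latticeIdeal k L)).comp (rename Subtype.val)

theorem chartMap_X (a : L) (b : {b : L // ¬ OppositeInDiamond a b}) :
    chartMap k a (X b) = Ideal.Quotient.mk (latticeIdeal k L) (X (b : L)) := by
  simp [chartMap]

/-- The variable of `a` itself, among those that are not opposite to `a`. -/
noncomputable def baseVar (k : Type*) [Field k] (a : L) :
    MvPolynomial {b : L // ¬ OppositeInDiamond a b} k :=
  X ⟨a, not_oppositeInDiamond_self a⟩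

theorem exists_pow_mul_eq_chartMap [Finite L] (a : L)
    (z : MvPolynomial L k ⧸ latticeIdeal k L) :
    ∃ (n : ℕ) (r : MvPolynomial {b : L // ¬ OppositeInDiamond a b} k),
      chartMap k a (baseVar k a) ^ n * z = chartMap k a r := by
  have hmul {y z : MvPolynomial L k ⧸ latticeIdeal k L}
      (hy : ∃ (n : ℕ) (r : MvPolynomial {b : L // ¬ OppositeInDiamond a b} k),
        chartMap k a (baseVar k a) ^ n * y = chartMap k a r)
      (hz : ∃ (n : ℕ) (r : MvPolynomial {b : L // ¬ OppositeInDiamond a b} k),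
        chartMap k a (baseVar k a) ^ n * z = chartMap k a r) :
      ∃ (n : ℕ) (r : MvPolynomial {b : L // ¬ OppositeInDiamond a b} k),
        chartMap k a (baseVar k a) ^ n * (y * z) = chartMap k a r := by
    obtain ⟨m, r, hr⟩ := hy
    obtain ⟨n, s, hs⟩ := hz
    exact ⟨m + n, r * s, by rw [map_mul, ← hr, ← hs]; ring⟩
  obtain ⟨F, rfl⟩ := Ideal.Quotient.mk_surjective z
  induction F using MvPolynomial.induction_on with
  | C t =>
    exact ⟨0, C t, by simp [chartMap]; rfl⟩
  | add p q hp hq =>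
    obtain ⟨m, r, hr⟩ := hp
    obtain ⟨n, s, hs⟩ := hq
    refine ⟨m + n, baseVar k a ^ n * r + baseVar k a ^ m * s, ?_⟩
    rw [map_add, map_add, map_mul, map_mul, ← hr, ← hs, map_pow, map_pow]
    ring
  | mul_X p g hp =>
    rw [map_mul]
    refine hmul hp ?_
    clear hp
    induction g using diamond_induction a with
    | base g hg => exact ⟨0, X ⟨g, hg⟩, by rw [pow_zero, one_mul, chartMap_X]⟩
    | step g u v h hu hv =>
      obtain ⟨n, r, hr⟩ := hmul hu hv
      refine ⟨n + 1, r, ?_⟩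
      rw [← hr, pow_succ, mul_assoc, ← map_mul, baseVar, chartMap_X, ← map_mul,
        Ideal.Quotient.eq.2 h.sub_mem_latticeIdeal]

/-- The monomial parametrization of the variety of the lattice. -/
noncomputable def toricMap (k L : Type*) [Field k] [DistribLattice L] [Finite L] :
    MvPolynomial L k ⧸ latticeIdeal k L →ₐ[k] MvPolynomial (joinIrreducibles L) k :=
  Ideal.Quotient.liftₐ (latticeIdeal k L) (aeval fun b => monomial (weight b) (1 : k)) (by
    intro F hF
    suffices h : latticeIdeal k L ≤
      RingHom.ker (aeval (R := k) fun b : L => monomial (weight b) (1 : k)) from h hF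
    rw [latticeIdeal, Ideal.span_le]
    rintro _ ⟨u, v, -, rfl⟩
    simp [weight_add_weight u v])

theorem toricMap_comp_chartMap_injective [Finite L] (a : L)
    (h : Nat.card {b : L // ¬ OppositeInDiamond a b} ≤ Nat.card (joinIrreducibles L)) :
    Function.Injective ((toricMap k L).comp (chartMap k a)) := by
  have : (toricMap k L).comp (chartMap k a) =
      aeval fun b : {b : L // ¬ OppositeInDiamond a b} => monomial (weight (b : L)) (1 : k) := by
    ext1 b
    rw [AlgHom.comp_apply, chartMap_X, aeval_X]
    exact aeval_X (R := k) (fun b : L => monomial (weight b) (1 : k)) (b : L)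
  rw [this]
  exact aeval_monomial_injective (linearIndependent_weight a h)

theorem isSmoothPoint_axisPoint [Finite L] (a : L) {c : k} (hc : c ≠ 0)
    (h : Nat.card {b : L // ¬ OppositeInDiamond a b} ≤ Nat.card (joinIrreducibles L)) :
    IsSmoothPoint (latticeIdeal k L) (axisPoint a c) := by
  have hp := axisPoint_mem_zeroLocus (k := k) a c
  refine ⟨hp, ?_⟩
  let m := pointIdeal (latticeIdeal k L) (axisPoint a c) hp
  let S := Localization.AtPrime m
  let A := MvPolynomial L k ⧸ latticeIdeal k L
  let R := MvPolynomial {b : L // ¬ OppositeInDiamond a b} k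
  let φ : R →+* A := (chartMap k a : R →+* A)
  have hinj : Function.Injective ((toricMap k L).comp (chartMap k a)) :=
    toricMap_comp_chartMap_injective a h
  let n : Ideal R := m.comap φ
  let _ : Algebra R S := ((algebraMap A S).comp φ).toAlgebra
  have halg (r : R) : algebraMap R S r = algebraMap A S (φ r) := rfl
  have hunit (r : R) : IsUnit (algebraMap A S (φ r)) ↔ r ∉ n :=
    IsLocalization.AtPrime.isUnit_to_map_iff S m (φ r)
  have hbase : baseVar k a ∉ n := by
    change ¬ evalAt _ _ hp (chartMap k a (baseVar k a)) = 0
    rw [baseVar, chartMap_X]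
    have : evalAt _ _ hp (Ideal.Quotient.mk (latticeIdeal k L) (X a)) = c :=
      (aeval_X (R := k) (axisPoint a c) a).trans (axisPoint_self a c)
    rwa [this]
  have hclear (z : A) : ∃ (t : n.primeCompl) (r : R), φ t * z = φ r := by
    obtain ⟨i, r, hr⟩ := exists_pow_mul_eq_chartMap a z
    exact ⟨⟨baseVar k a, hbase⟩ ^ i, r, by simpa [φ] using hr⟩
  -- `S` localizes the polynomial ring `R` too: `hclear` turns denominators and numerators into
  -- images from `R`, and `hinj` lets equalities descend to `R`.
  have hloc : IsLocalization.AtPrime S n := by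
    refine ⟨fun t => (hunit t).2 t.2, fun z => ?_, fun {x y} hxy => ?_⟩
    · obtain ⟨⟨f, s⟩, hs⟩ := IsLocalization.surj m.primeCompl z
      obtain ⟨t, r, hr⟩ := hclear f
      obtain ⟨t', r', hr'⟩ := hclear s
      have hr'n : r' ∉ n := by
        rw [← hunit, ← hr', map_mul]
        exact ((hunit _).2 t'.2).mul (IsLocalization.map_units S s)
      -- From `t f = r` and `t' s = r'`, the fraction `f / s` is `t' r / (t r')`.
      refine ⟨⟨t' * r, t * ⟨r', hr'n⟩⟩, ?_⟩
      simp only [halg, map_mul, Submonoid.coe_mul, ← hr, ← hr']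
      simp only at hs
      rw [← hs]
      ring
    · obtain ⟨s, hs⟩ := (IsLocalization.eq_iff_exists m.primeCompl S).1 hxy
      obtain ⟨t, r, hr⟩ := hclear s
      have hrn : r ∉ n := by
        rw [← hunit, ← hr, map_mul]
        exact ((hunit _).2 t.2).mul (IsLocalization.map_units S s)
      refine ⟨1, ?_⟩
      have hrxy : φ (r * x) = φ (r * y) := by
        rw [map_mul, map_mul, ← hr, mul_assoc, mul_assoc]
        exact congrArg (φ t * ·) hs
      have hrxy' : r * x = r * y := hinj (congrArg (toricMap k L) hrxy)
      -- The factor `r` cancels because `R` is a domain.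
      have hr0 : r ≠ 0 := fun e => hrn (e ▸ n.zero_mem)
      rw [mul_left_cancel₀ hr0 hrxy']
  exact IsRegularLocalRing.of_ringEquiv
    (IsLocalization.algEquiv n.primeCompl (Localization.AtPrime n) S).toRingEquiv

end LocalRing

theorem theorema (k : Type*) [Field k] (L : Type*) [DistribLattice L] [Fintype L]
    (a : L) (c : k) (hc : c ≠ 0) :
    axisPoint a c ∈ MvPolynomial.zeroLocus k (latticeIdeal k L) ∧
    (diamondPairs a).ncard ≤ (jacobianAt (diamondRelations k L) (axisPoint a c)).rank ∧
    (((diamondPairs a).ncard : ℤ) ≥ (Fintype.card L : ℤ) - ((joinIrreducibles L).ncard : ℤ) →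
      IsSmoothPoint (latticeIdeal k L) (axisPoint a c)) := by
  refine ⟨axisPoint_mem_zeroLocus a c, ncard_diamondPairs_le_rank_jacobianAt a hc, fun h => ?_⟩
  refine isSmoothPoint_axisPoint a hc ?_
  classical
  have hcard := Fintype.card_subtype_compl (OppositeInDiamond a)
  -- This bound makes the truncated subtraction in `hcard` a true one.
  have hle := Fintype.card_subtype_le (OppositeInDiamond a)
  rw [ncard_diamondPairs, Nat.card_eq_fintype_card] at h
  rw [Nat.card_coe_set_eq, Nat.card_eq_fintype_card, hcard]
  omega
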